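/- Let $M, N \ge 0$ be integers with $N \ge 4M-4$ and $N \ge M$ (the second condition, which is needed for $N$ vectors to span $\mathbb{C}^M$, follows from the first if $M \ge 2$). An $N$-element complex frame is a collection $\Phi = (\phi_1, \dots, \phi_N)$ of vectors spanning $\mathbb{C}^M$. For such $\Phi$ let $$\mathcal{A}_\Phi : \mathbb{C}^M/S^1 \to (\mathbb{R}_{\ge 0})^N, \qquad x \mapsto \left(|\langle x, \phi_n\rangle|^2\right)_{n=1,\dots,N},$$ where $\langle x, y\rangle = \sum_{m=1}^M x_m \overline{y_m}$ and $\mathbb{C}^M/S^1$ is obtained from $\mathbb{C}^M$ by identifying $x$ with $e^{i\theta}x$ for all $\theta \in \mathbb{R}$. Then $\mathcal{A}_\Phi$ is injective for a generic frame $\Phi$. That is, identify $(U,V) \in (\mathbb{R}^{M\times N})^2$ with the $N$-tuple of columns of $U + iV \in \mathbb{C}^{M \times N}$; then there is a non-empty Zariski open subset $\mathcal{U} \subseteq (\mathbb{R}^{M\times N})^2$ (the complement of the common zero set of finitely many real polynomials in the $2MN$ entries of $U$ and $V$) such that every point of $\mathcal{U}$ corresponds to a frame $\Phi$ for which $\mathcal{A}_\Phi$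 is injective. -/

import Mathlib

open scoped NNReal

namespace PhaseRetrieval

section Zariski

variable {σ F : Type*} [Field F]

/-- An affine variety: the common zero set of finitely many polynomials. -/
def IsAffineVariety (Z : Set (σ → F)) : Prop :=
  ∃ S : Finset (MvPolynomial σ F), Z = {x | ∀ p ∈ S, MvPolynomial.eval x p = 0}

/-- A Zariski open set: the complement of an affine variety. -/
def IsZariskiOpen (U : Set (σ → F)) : Prop :=
  IsAffineVariety Uᶜ

/-- A generic point of affine space has property `P`: some non-empty Zariski open set consists
of points having property `P`. -/
def Generically (P : (σ → F) → Prop) : Prop :=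
  ∃ U : Set (σ → F), IsZariskiOpen U ∧ U.Nonempty ∧ ∀ x ∈ U, P x

end Zariski

/-- The coordinates on `(ℝ^{M × N})²`: `Sum.inl (m, n)` is the `(m, n)` entry of the first matrix,
`Sum.inr (m, n)` that of the second one. -/
abbrev Coord (M N : ℕ) : Type :=
  (Fin M × Fin N) ⊕ (Fin M × Fin N)

/-- The identification of `(ℝ^{M × N})²` with the `N`-tuples of vectors of `ℂ^M`: the pair `(U, V)`
corresponds to the columns of `U + iV`. -/
noncomputable def realCoordEquiv (M N : ℕ) :
    (Coord M N → ℝ) ≃ (Fin N → EuclideanSpace ℂ (Fin M)) where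
  toFun a n := WithLp.toLp 2 fun m => (⟨a (Sum.inl (m, n)), a (Sum.inr (m, n))⟩ : ℂ)
  invFun φ := Sum.elim (fun p => (φ p.2 p.1).re) (fun p => (φ p.2 p.1).im)
  left_inv a := by
    funext i
    rcases i with ⟨m, n⟩ | ⟨m, n⟩ <;> rfl
  right_inv φ := by
    funext n
    ext m
    rfl

/-- A complex frame: finitely many vectors spanning `ℂ^M`. -/
def IsFrame {M N : ℕ} (φ : Fin N → EuclideanSpace ℂ (Fin M)) : Prop :=
  Submodule.span ℂ (Set.range φ) = ⊤

/-- The quotient `ℂ^M / S¹` of `ℂ^M` by multiplication with scalars of modulus one. -/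
abbrev PhaseQuotient (M : ℕ) : Type :=
  MulAction.orbitRel.Quotient Circle (EuclideanSpace ℂ (Fin M))

/-- The intensity map `ℂ^M / S¹ → (ℝ_{≥ 0})^N`, `x ↦ (|⟨x, φ_n⟩|²)_n`, where
`⟨x, y⟩ = ∑ x_m conj y_m` is `inner ℂ y x`. -/
noncomputable def intensityMap {M N : ℕ} (φ : Fin N → EuclideanSpace ℂ (Fin M)) :
    PhaseQuotient M → (Fin N → ℝ≥0) :=
  Quotient.lift (fun x n => ‖inner ℂ (φ n) x‖₊ ^ 2) (by
    rintro x y ⟨c, rfl⟩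
    funext n
    have h : inner ℂ (φ n) ((c : ℂ) • y) = (c : ℂ) * inner ℂ (φ n) y := inner_smul_right _ _ _
    have hc : ‖(c : ℂ)‖₊ = 1 := NNReal.eq (Circle.norm_coe c)
    change ‖inner ℂ (φ n) ((c : ℂ) • y)‖₊ ^ 2 = ‖inner ℂ (φ n) y‖₊ ^ 2
    rw [h, nnnorm_mul, hc, one_mul])

end PhaseRetrieval

/-!
The argument is a dimension count, carried out with a generic point instead of with projections of
varieties.

Two vectors `x, y` that are not phases of each other and have equal intensities give a non-zero
Hermitian matrix `p = x xᴴ - y yᴴ` of rank at most two such that `∑ p_jk conj(φ_n j) (φ_n k) = 0`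
for all `n` (a frame that does not span is covered by `y = 0`). Up to scaling, matrices of rank at
most two form a family of dimension at most `max (2M - 2) (4M - 5) < N`
(`exists_generators_of_rank_le_two`), and for a given `p` each equation removes one of the `2M`
degrees of freedom of `φ_n` (`exists_generators_of_bilinear_relation`). So the ambiguous frames
depend on fewer than `N + N (2M - 1) = 2MN` parameters.

To conclude that a single non-zero polynomial vanishes on all ambiguous frames, suppose that none
does. Then there is a field `K ⊇ ℝ`, a quotient of the ring of complex functions on the set of
ambiguous frames followed by passage to fractions, in which the `2MN` coordinate functions become
algebraically independent over `ℝ` (`exists_field_algebraicIndependent`). Choosing `x, y` for each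
ambiguous frame gives elements of `K` satisfying the same equations; there the entries
of `φ_n` and of `conj φ_n` are treated as separate coordinates `Z n`, `W n`. The count above then
puts all `2MN` coordinates into a field algebraic over one with fewer than `2MN` generators, which
contradicts `AlgebraicIndependent.card_le_of_forall_subfield`.
-/

universe u

/-! ### Generic points and transcendence degree -/

open MvPolynomial in
/-- A set of real points on which no non-zero polynomial vanishes has a generic point: the ring of
all complex functions on the set maps to a field in which the coordinate functions are algebraically
independent over `ℝ`. Identities that hold at every point of the set, with auxiliary values chosen
pointwise, are inherited by that field. -/
theorem exists_field_algebraicIndependent {σ : Type u} (S : Set (σ → ℝ))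
    (hS : ∀ p : MvPolynomial σ ℝ, p ≠ 0 → ∃ s ∈ S, eval s p ≠ 0) :
    ∃ (K : Type u) (_ : Field K) (_ : Algebra ℝ K) (π : (S → ℂ) →ₐ[ℝ] K),
      AlgebraicIndependent ℝ fun i => π fun s => ((s.1 i : ℝ) : ℂ) := by
  let e : MvPolynomial σ ℝ →ₐ[ℝ] (S → ℂ) := aeval fun i s => ((s.1 i : ℝ) : ℂ)
  have he (p : MvPolynomial σ ℝ) (s : S) : e p s = ((eval s.1 p : ℝ) : ℂ) := by
    have h : (Pi.evalAlgHom ℝ (fun _ : S => ℂ) s).comp e =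
        (Complex.ofRealAm).comp (aeval s.1) := by
      ext i
      simp [e]
    simpa [aeval_eq_eval] using DFunLike.congr_fun h p
  -- A prime ideal that avoids the image of all non-zero polynomials gives the required quotient.
  let T : Submonoid (S → ℂ) := (nonZeroDivisors (MvPolynomial σ ℝ)).map e
  obtain ⟨P, hP, -, hPT⟩ := Ideal.exists_le_prime_disjoint (⊥ : Ideal (S → ℂ)) T (by
    rw [Set.disjoint_left]
    rintro _ h0 ⟨p, hp, rfl⟩
    obtain ⟨s, hs, hsp⟩ := hS p (nonZeroDivisors.ne_zero hp)
    have h := congr_fun (show e p = 0 from h0) ⟨s, hs⟩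
    rw [he] at h
    exact hsp (Complex.ofReal_eq_zero.1 h))
  let π : (S → ℂ) →ₐ[ℝ] FractionRing ((S → ℂ) ⧸ P) :=
    (IsScalarTower.toAlgHom ℝ ((S → ℂ) ⧸ P) _).comp (Ideal.Quotient.mkₐ ℝ P)
  refine ⟨FractionRing ((S → ℂ) ⧸ P), inferInstance, inferInstance, π, ?_⟩
  rw [algebraicIndependent_iff]
  intro p hp
  have h1 : aeval (fun i => π fun s => ((s.1 i : ℝ) : ℂ)) p = π (e p) := by
    have h : aeval (fun i => π fun s => ((s.1 i : ℝ) : ℂ)) = π.comp e := by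
      ext i
      simp [e]
    rw [h]; rfl
  rw [h1] at hp
  have h2 : Ideal.Quotient.mk P (e p) = 0 :=
    IsFractionRing.injective ((S → ℂ) ⧸ P) (FractionRing ((S → ℂ) ⧸ P))
      (hp.trans (map_zero _).symm)
  by_contra hp0
  exact Set.disjoint_left.mp hPT (Ideal.Quotient.eq_zero_iff_mem.mp h2)
    ⟨p, mem_nonZeroDivisors_of_ne_zero hp0, rfl⟩

/-- A family of elements that lie in the relative algebraic closure of `F(B)` and are algebraically
independent over `F` has at most `B.card` members. The closure enters only through the subfields
that contain `B` and all elements algebraic over `F`. -/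
theorem AlgebraicIndependent.card_le_of_forall_subfield {F K ι : Type*} [Field F] [Field K]
    [Algebra F K] [Fintype ι] {a : ι → K} (ha : AlgebraicIndependent F a) (B : Finset K)
    (h : ∀ L : Subfield K, (∀ z, IsAlgebraic F z → z ∈ L) → (∀ z ∈ B, z ∈ L) → ∀ i, a i ∈ L) :
    Fintype.card ι ≤ B.card := by
  let C := Subalgebra.algebraicClosure (Algebra.adjoin F (B : Set K)) K
  let L : Subfield K :=
    { C.toSubring with
      inv_mem' := fun z hz => by
        have hz' : IsAlgebraic (Algebra.adjoin F (B : Set K)) z := hz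
        exact hz'.inv }
  have hL (z : K) : z ∈ L ↔ IsAlgebraic (Algebra.adjoin F (B : Set K)) z := Iff.rfl
  have hr : Set.range a ⊆ (AlgebraicIndependent.matroid F K).closure B := by
    rw [AlgebraicIndependent.matroid_closure_eq]
    rintro _ ⟨i, rfl⟩
    refine h L (fun z hz => (hL z).2 (hz.extendScalars ?_)) (fun z hz => (hL z).2 ?_) i
    · exact FaithfulSMul.algebraMap_injective F _
    · exact isAlgebraic_algebraMap (⟨z, Algebra.subset_adjoin hz⟩ : Algebra.adjoin F (B : Set K))
  have hI : (AlgebraicIndependent.matroid F K).Indep (Set.range a) :=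
    AlgebraicIndependent.matroid_indep_iff.2 ha.coe_range
  have h1 := (AlgebraicIndependent.matroid F K).eRk_mono hr
  rw [hI.eRk_eq_encard, Matroid.eRk_closure_eq] at h1
  have h2 := h1.trans (Matroid.eRk_le_encard _ _)
  rw [← Set.image_univ, ha.injective.injOn.encard_image, Set.encard_univ,
    Set.encard_coe_eq_coe_finsetCard, ENat.card_eq_coe_fintype_card] at h2
  exact_mod_cast h2

/-! ### Parameters of matrices of rank at most two -/

/-- A matrix `x x'ᵀ - y y'ᵀ`, normalized to have a given entry equal to one, has its entries in a
field with at most `max (2M - 2) (4M - 5)` generators. The first bound is the dimension of the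
projectivized matrices of rank one, the second that for rank two. -/
theorem exists_generators_of_rank_le_two {K ι : Type*} [Field K] [Fintype ι] [DecidableEq ι]
    (x x' y y' : ι → K) (a b : ι) (hab : x a * x' b - y a * y' b ≠ 0) :
    ∃ G : Finset K, (G.card + 2 ≤ 2 * Fintype.card ι ∨ G.card + 5 ≤ 4 * Fintype.card ι) ∧
      ∀ L : Subfield K, (∀ z ∈ G, z ∈ L) →
        ∀ j k, (x j * x' k - y j * y' k) / (x a * x' b - y a * y' b) ∈ L := by
  classical
  set t := x a * x' b - y a * y' b with ht
  let q (j k : ι) : K := (x j * x' k - y j * y' k) / t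
  have hq (j k : ι) : q j k * t = x j * x' k - y j * y' k := div_mul_cancel₀ _ hab
  -- The Schur complement of the entry `(a, b)`: its rank is at most one, which is `hrr`, and its
  -- row `a` and column `b` vanish.
  let r (j k : ι) : K := q j k - q j b * q a k
  have hrr (j k c d : ι) : r j k * r c d = r j d * r c k := by
    simp only [r, q]
    field_simp
    rw [ht]
    ring
  have hqab : q a b = 1 := div_self hab
  have hra (k : ι) : r a k = 0 := by simp [r, hqab]
  have hrb (j : ι) : r j b = 0 := by simp [r, hqab]
  let G₁ : Finset K := (Finset.univ.erase b).image (q a)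
  let G₂ : Finset K := (Finset.univ.erase a).image fun j => q j b
  have hcard (i : ι) : (Finset.univ.erase i).card + 1 = Fintype.card ι :=
    Finset.card_erase_add_one (Finset.mem_univ i)
  have hG₁ : G₁.card + 1 ≤ Fintype.card ι :=
    (Nat.add_le_add_right Finset.card_image_le 1).trans (hcard b).le
  have hG₂ : G₂.card + 1 ≤ Fintype.card ι :=
    (Nat.add_le_add_right Finset.card_image_le 1).trans (hcard a).le
  have hrow (L : Subfield K) (hL : ∀ z ∈ G₁, z ∈ L) (k : ι) : q a k ∈ L := by
    by_cases hk : k = b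
    · rw [hk, hqab]; exact L.one_mem
    · exact hL _ (Finset.mem_image_of_mem _ (by simpa using hk))
  have hcol (L : Subfield K) (hL : ∀ z ∈ G₂, z ∈ L) (j : ι) : q j b ∈ L := by
    by_cases hj : j = a
    · rw [hj, hqab]; exact L.one_mem
    · exact hL _ (Finset.mem_image_of_mem (fun j => q j b) (by simpa using hj))
  have hqr (j k : ι) : q j k = r j k + q j b * q a k := by simp [r]
  by_cases hr : ∀ j k, r j k = 0
  · refine ⟨G₁ ∪ G₂, Or.inl ?_, fun L hL j k => ?_⟩
    · have := Finset.card_union_le G₁ G₂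
      omega
    · change q j k ∈ L
      rw [hqr, hr, zero_add]
      exact L.mul_mem (hcol L (fun z hz => hL z (Finset.mem_union_right _ hz)) j)
        (hrow L (fun z hz => hL z (Finset.mem_union_left _ hz)) k)
  · push Not at hr
    obtain ⟨c, d, hcd⟩ := hr
    have hca : c ≠ a := by rintro rfl; exact hcd (hra d)
    -- As `r` has rank one and `r c d ≠ 0`, row `c` and column `d` of `r` determine it.
    let G₃ : Finset K := (Finset.univ.erase b).image (r c)
    let G₄ : Finset K := ((Finset.univ.erase a).erase c).image fun j => r j d
    have hG₃ : G₃.card + 1 ≤ Fintype.card ι :=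
      (Nat.add_le_add_right Finset.card_image_le 1).trans (hcard b).le
    have hG₄ : G₄.card + 2 ≤ Fintype.card ι := by
      have h1 : ((Finset.univ.erase a).erase c).card + 1 = (Finset.univ.erase a).card :=
        Finset.card_erase_add_one (by simpa using hca)
      have h2 : G₄.card ≤ ((Finset.univ.erase a).erase c).card := Finset.card_image_le
      have := hcard a
      omega
    refine ⟨G₁ ∪ G₂ ∪ (G₃ ∪ G₄), Or.inr ?_, fun L hL j k => ?_⟩
    · have h1 := Finset.card_union_le G₁ G₂
      have h2 := Finset.card_union_le G₃ G₄
      have h3 := Finset.card_union_le (G₁ ∪ G₂) (G₃ ∪ G₄)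
      omega
    · change q j k ∈ L
      have hrc (k : ι) : r c k ∈ L := by
        by_cases hk : k = b
        · rw [hk, hrb]; exact L.zero_mem
        · exact hL _ (Finset.mem_union_right _ (Finset.mem_union_left _
            (Finset.mem_image_of_mem _ (by simpa using hk))))
      have hrd (j : ι) : r j d ∈ L := by
        by_cases hj : j = a
        · rw [hj, hra]; exact L.zero_mem
        by_cases hj' : j = c
        · rw [hj']; exact hrc d
        · exact hL _ (Finset.mem_union_right _ (Finset.mem_union_right _
            (Finset.mem_image_of_mem (fun j => r j d) (by simp [hj, hj']))))
      have hrjk : r j k = r j d * r c k / r c d := by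
        rw [eq_div_iff hcd, hrr]
      rw [hqr, hrjk]
      refine L.add_mem (L.div_mem (L.mul_mem (hrd j) (hrc k)) (hrc d)) (L.mul_mem ?_ ?_)
      · exact hcol L (fun z hz =>
          hL z (Finset.mem_union_left _ (Finset.mem_union_right _ hz))) j
      · exact hrow L (fun z hz =>
          hL z (Finset.mem_union_left _ (Finset.mem_union_left _ hz))) k

/-! ### A bilinear relation removes one parameter -/

/-- Over a field containing the entries of `q ≠ 0`, one of the `2M` coordinates of a zero `(Z, W)`
of the bilinear form `q` is a rational function of the others. -/
theorem exists_generators_of_bilinear_relation {K ι : Type*} [Field K] [Fintype ι]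
    (q : ι → ι → K) (Z W : ι → K) (a b : ι) (hab : q a b ≠ 0)
    (h : ∑ j, ∑ k, q j k * W j * Z k = 0) :
    ∃ G : Finset K, G.card + 1 ≤ 2 * Fintype.card ι ∧
      ∀ L : Subfield K, (∀ j k, q j k ∈ L) → (∀ z ∈ G, z ∈ L) → ∀ j, Z j ∈ L ∧ W j ∈ L := by
  classical
  let v : ι ⊕ ι → K := Sum.elim Z W
  have hcard (i : ι ⊕ ι) : ((Finset.univ.erase i).image v).card + 1 ≤ 2 * Fintype.card ι := by
    have h1 : (Finset.univ.erase i).card + 1 = Fintype.card (ι ⊕ ι) :=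
      Finset.card_erase_add_one (Finset.mem_univ i)
    have h2 : ((Finset.univ.erase i).image v).card ≤ _ := Finset.card_image_le
    rw [Fintype.card_sum] at h1
    omega
  have key (i : ι ⊕ ι) (L : Subfield K) (hL : ∀ z ∈ (Finset.univ.erase i).image v, z ∈ L)
      (hi : v i ∈ L) (j : ι) : Z j ∈ L ∧ W j ∈ L := by
    have hv (l : ι ⊕ ι) : v l ∈ L := by
      by_cases hl : l = i
      · rwa [hl]
      · exact hL _ (Finset.mem_image_of_mem _ (by simpa using hl))
    exact ⟨hv (Sum.inl j), hv (Sum.inr j)⟩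
  -- The coefficient of `Z b` in the relation. If it vanishes, that is a linear relation among the
  -- `W j` in which `W a` has the coefficient `q a b ≠ 0`; otherwise the relation gives `Z b`.
  by_cases hs : ∑ j, q j b * W j = 0
  · refine ⟨(Finset.univ.erase (Sum.inr a)).image v, hcard _, fun L hq hL => key _ L hL ?_⟩
    rw [← Finset.add_sum_erase _ _ (Finset.mem_univ a)] at hs
    have h1 : W a = -(∑ j ∈ Finset.univ.erase a, q j b * W j) / q a b := by
      rw [eq_div_iff hab]
      linear_combination hs
    change W a ∈ L
    rw [h1]
    refine L.div_mem (L.neg_mem (L.sum_mem fun j hj => L.mul_mem (hq _ _) (hL _ ?_))) (hq _ _)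
    exact Finset.mem_image.2 ⟨Sum.inr j, by simpa using hj, rfl⟩
  · refine ⟨(Finset.univ.erase (Sum.inl b)).image v, hcard _, fun L hq hL => key _ L hL ?_⟩
    have hW (j : ι) : W j ∈ L := hL _ (Finset.mem_image.2 ⟨Sum.inr j, by simp, rfl⟩)
    rw [Finset.sum_comm, ← Finset.add_sum_erase _ _ (Finset.mem_univ b), ← Finset.sum_mul] at h
    have h1 : Z b = -(∑ k ∈ Finset.univ.erase b, ∑ j, q j k * W j * Z k) / ∑ j, q j b * W j := by
      rw [eq_div_iff hs]
      linear_combination h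
    change Z b ∈ L
    rw [h1]
    refine L.div_mem (L.neg_mem (L.sum_mem fun k hk => L.sum_mem fun j _ =>
      L.mul_mem (L.mul_mem (hq _ _) (hW _)) (hL _ ?_)))
      (L.sum_mem fun j _ => L.mul_mem (hq _ _) (hW _))
    exact Finset.mem_image.2 ⟨Sum.inl k, by simpa using hk, rfl⟩

namespace PhaseRetrieval

open scoped ComplexConjugate

/-! ### Ambiguous systems of vectors -/

/-- The coordinates of the systems `φ` for which some `x, y` with `x xᴴ ≠ y yᴴ` have the same
intensities. The condition `x xᴴ ≠ y yᴴ`, stated entrywise, says that `x` and `y` differ in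
`ℂ^M / S¹`. -/
def ambiguousSet (M N : ℕ) : Set (Coord M N → ℝ) :=
  {a | ∃ x y : EuclideanSpace ℂ (Fin M),
    (∃ j k, x j * conj (x k) ≠ y j * conj (y k)) ∧
      ∀ n, ‖inner ℂ (realCoordEquiv M N a n) x‖ = ‖inner ℂ (realCoordEquiv M N a n) y‖}

theorem normSq_inner {M : ℕ} (φ x : EuclideanSpace ℂ (Fin M)) :
    ((‖inner ℂ φ x‖ ^ 2 : ℝ) : ℂ) =
      ∑ j, ∑ k, x j * conj (x k) * conj (φ j) * φ k := by
  rw [Complex.ofReal_pow, ← Complex.mul_conj', PiLp.inner_apply]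
  simp only [RCLike.inner_apply, map_sum, map_mul, Complex.conj_conj]
  rw [Finset.sum_mul_sum]
  exact Finset.sum_congr rfl fun j _ => Finset.sum_congr rfl fun k _ => by ring

theorem exists_circle_smul_eq {M : ℕ} {x y : EuclideanSpace ℂ (Fin M)}
    (h : ∀ j k, x j * conj (x k) = y j * conj (y k)) : ∃ c : Circle, c • y = x := by
  by_cases hy : y = 0
  · refine ⟨1, ?_⟩
    ext j
    have := h j j
    simp_all
  · obtain ⟨k, hk⟩ : ∃ k, y k ≠ 0 := by
      by_contra! h0
      exact hy (by ext j; simpa using h0 j)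
    have hn : ‖x k‖ = ‖y k‖ := by
      have h1 := congrArg norm (h k k)
      simp only [norm_mul, RCLike.norm_conj] at h1
      exact (mul_self_inj (norm_nonneg _) (norm_nonneg _)).1 h1
    have hxk : x k ≠ 0 := norm_ne_zero_iff.1 (hn ▸ norm_ne_zero_iff.2 hk)
    refine ⟨⟨x k / y k, mem_sphere_zero_iff_norm.2 ?_⟩, ?_⟩
    · rw [norm_div, hn, div_self (norm_ne_zero_iff.2 hk)]
    · ext j
      change x k / y k * y j = x j
      have hc : conj (x k) ≠ 0 := (map_ne_zero _).2 hxk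
      rw [div_mul_eq_mul_div, div_eq_iff hk]
      apply mul_right_cancel₀ hc
      have h1 := h k k
      have h2 := h j k
      linear_combination y j * h1 - y k * h2

theorem injective_intensityMap_of_notMem {M N : ℕ} {a : Coord M N → ℝ}
    (ha : a ∉ ambiguousSet M N) : Function.Injective (intensityMap (realCoordEquiv M N a)) := by
  intro X Y
  induction X using Quotient.inductionOn with | _ x
  induction Y using Quotient.inductionOn with | _ y
  intro h
  refine Quotient.sound ?_
  change x ∈ MulAction.orbit Circle y
  refine exists_circle_smul_eq fun j k => ?_
  by_contra hjk
  refine ha ⟨x, y, ⟨j, k, hjk⟩, fun n => ?_⟩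
  have h1 : ‖inner ℂ (realCoordEquiv M N a n) x‖₊ ^ 2 =
    ‖inner ℂ (realCoordEquiv M N a n) y‖₊ ^ 2 := congr_fun h n
  exact congrArg NNReal.toReal (pow_left_injective two_ne_zero h1)

/-- A vector orthogonal to all `φ n` has the intensities of `0`, so it is `0` in the quotient. -/
theorem isFrame_of_injective_intensityMap {M N : ℕ} {φ : Fin N → EuclideanSpace ℂ (Fin M)}
    (h : Function.Injective (intensityMap φ)) : IsFrame φ := by
  rw [IsFrame, ← Submodule.orthogonal_eq_bot_iff, Submodule.eq_bot_iff]
  intro x hx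
  have h1 : (Quotient.mk _ x : PhaseQuotient M) = Quotient.mk _ 0 := by
    apply h
    funext n
    have h2 : inner ℂ (φ n) x = 0 := hx _ (Submodule.subset_span ⟨n, rfl⟩)
    change ‖inner ℂ (φ n) x‖₊ ^ 2 = ‖inner ℂ (φ n) (0 : EuclideanSpace ℂ (Fin M))‖₊ ^ 2
    rw [h2, inner_zero_right]
  obtain ⟨c, hc⟩ : x ∈ MulAction.orbit Circle (0 : EuclideanSpace ℂ (Fin M)) := Quotient.exact h1
  exact hc.symm.trans (smul_zero (c : ℂ))

/-! ### The dimension count -/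

open MvPolynomial in
/-- The ambiguous systems lie in a real hypersurface, as they depend on fewer than `2MN`
parameters. -/
theorem exists_polynomial_vanishing_on_ambiguousSet {M N : ℕ} (hMN : M ≤ N)
    (hN : 4 * M ≤ N + 4) :
    ∃ p : MvPolynomial (Coord M N) ℝ, p ≠ 0 ∧ ∀ a ∈ ambiguousSet M N, eval a p = 0 := by
  classical
  by_contra! hS
  obtain ⟨K, _, _, π, hind⟩ := exists_field_algebraicIndependent (ambiguousSet M N) hS
  choose x y hxy hnorm using fun s : ambiguousSet M N => s.2
  let φ (s : ambiguousSet M N) := realCoordEquiv M N s.1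
  let X (j : Fin M) : K := π fun s => x s j
  let X' (j : Fin M) : K := π fun s => conj (x s j)
  let Y (j : Fin M) : K := π fun s => y s j
  let Y' (j : Fin M) : K := π fun s => conj (y s j)
  let Z (n : Fin N) (j : Fin M) : K := π fun s => φ s n j
  let W (n : Fin N) (j : Fin M) : K := π fun s => conj (φ s n j)
  have hrel (n : Fin N) : ∑ j, ∑ k, (X j * X' k - Y j * Y' k) * W n j * Z n k = 0 := by
    simp only [X, X', Y, Y', Z, W, ← map_mul, ← map_sub, ← map_sum]
    rw [← map_zero π]
    congr 1
    funext s
    have h1 := normSq_inner (φ s n) (x s)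
    rw [hnorm s n, normSq_inner] at h1
    simp only [Finset.sum_apply, Pi.mul_apply, Pi.sub_apply, Pi.zero_apply, sub_mul,
      Finset.sum_sub_distrib]
    exact sub_eq_zero.2 h1.symm
  obtain ⟨a, b, hab⟩ : ∃ a b, X a * X' b - Y a * Y' b ≠ 0 := by
    by_contra! h0
    let f (j k : Fin M) (s : ambiguousSet M N) : ℂ := x s j * conj (x s k) - y s j * conj (y s k)
    have hf (j k : Fin M) : π (f j k) = 0 := by
      rw [← h0 j k]
      simp only [X, X', Y, Y', ← map_mul, ← map_sub]
      rfl
    -- The non-vanishing of the matrix has to be carried to `K` by an identity: the sum of the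
    -- squared absolute values of its entries has the inverse `g`.
    let g : ambiguousSet M N → ℂ := fun s => (∑ j, ∑ k, f j k s * conj (f j k s))⁻¹
    have hg : (∑ j, ∑ k, f j k * fun s => conj (f j k s)) * g = 1 := by
      funext s
      simp only [Pi.mul_apply, Finset.sum_apply, Pi.one_apply, g]
      apply mul_inv_cancel₀
      obtain ⟨j, k, hjk⟩ := hxy s
      simp only [Complex.mul_conj, ← Complex.ofReal_sum]
      refine Complex.ofReal_ne_zero.2 (ne_of_gt ?_)
      refine Finset.sum_pos' (fun _ _ => Finset.sum_nonneg fun _ _ => Complex.normSq_nonneg _)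
        ⟨j, Finset.mem_univ j, Finset.sum_pos' (fun _ _ => Complex.normSq_nonneg _)
        ⟨k, Finset.mem_univ k, Complex.normSq_pos.2 (sub_ne_zero.2 hjk)⟩⟩
    have := congrArg π hg
    simp [map_sum, hf] at this
  obtain ⟨G, hGcard, hG⟩ := exists_generators_of_rank_le_two X X' Y Y' a b hab
  set t := X a * X' b - Y a * Y' b
  let q (j k : Fin M) : K := (X j * X' k - Y j * Y' k) / t
  have hqrel (n : Fin N) : ∑ j, ∑ k, q j k * W n j * Z n k = 0 := by
    have h1 : ∑ j, ∑ k, q j k * W n j * Z n k =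
        (∑ j, ∑ k, (X j * X' k - Y j * Y' k) * W n j * Z n k) / t := by
      simp only [Finset.sum_div, q]
      exact Finset.sum_congr rfl fun j _ => Finset.sum_congr rfl fun k _ => by ring
    rw [h1, hrel, zero_div]
  have hqab : q a b ≠ 0 := div_ne_zero hab hab
  choose H hHcard hH using fun n =>
    exists_generators_of_bilinear_relation q (Z n) (W n) a b hqab (hqrel n)
  have hcard := hind.card_le_of_forall_subfield (G ∪ Finset.univ.biUnion H) (by
    intro L halg hL
    have hZW (n : Fin N) (m : Fin M) : Z n m ∈ L ∧ W n m ∈ L :=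
      hH n L (hG L fun z hz => hL z (Finset.mem_union_left _ hz))
        (fun z hz => hL z (Finset.mem_union_right _
          (Finset.mem_biUnion.2 ⟨n, Finset.mem_univ n, hz⟩))) m
    -- The real and imaginary parts are recovered from `Z` and `W` by means of the image `i` of the
    -- imaginary unit, which is algebraic over `ℝ`.
    let i : K := π fun _ => Complex.I
    have hi2 : i ^ 2 = -1 := by
      simp only [i, ← map_pow]
      rw [← map_one π, ← map_neg]
      congr 1
      funext s
      simp
    have hi : i ∈ L := halg _ ⟨Polynomial.X ^ 2 + 1,
      (Polynomial.monic_X_pow_add_C (1 : ℝ) two_ne_zero).ne_zero, by simp [hi2]⟩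
    have : CharZero K := charZero_of_injective_algebraMap (algebraMap ℝ K).injective
    have h2 : (2 : K) ∈ L := ofNat_mem L 2
    have hi0 : i ≠ 0 := by
      rintro h0
      simp [h0] at hi2
    rintro (⟨m, n⟩ | ⟨m, n⟩)
    · have h1 : (π fun s => ((s.1 (Sum.inl (m, n)) : ℝ) : ℂ)) = (Z n m + W n m) / 2 := by
        rw [eq_div_iff two_ne_zero]
        rw [← map_ofNat π 2]
        simp only [Z, W, ← map_mul, ← map_add]
        congr 1
        funext s
        apply Complex.ext <;> simp [φ, realCoordEquiv, mul_two]
      rw [h1]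
      exact L.div_mem (L.add_mem (hZW n m).1 (hZW n m).2) h2
    · have h1 : (π fun s => ((s.1 (Sum.inr (m, n)) : ℝ) : ℂ)) = (Z n m - W n m) / (2 * i) := by
        rw [eq_div_iff (mul_ne_zero two_ne_zero hi0)]
        rw [← map_ofNat π 2]
        simp only [Z, W, i, ← map_mul, ← map_sub]
        congr 1
        funext s
        apply Complex.ext <;> simp [φ, realCoordEquiv, mul_two]
      rw [h1]
      exact L.div_mem (L.sub_mem (hZW n m).1 (hZW n m).2) (L.mul_mem h2 hi))
  have h1 := Finset.card_union_le G (Finset.univ.biUnion H)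
  have h2 : (Finset.univ.biUnion H).card ≤ ∑ n, (H n).card := Finset.card_biUnion_le
  have h3 : ∑ n, ((H n).card + 1) ≤ ∑ _n : Fin N, 2 * M :=
    Finset.sum_le_sum fun n _ => by simpa using hHcard n
  have hM : 0 < M := a.pos
  -- For `M = 1` the bound `2M - 2 = 0 < N` needs `M ≤ N`; for `M ≥ 2` it follows from `hN`.
  have h4 : G.card < N := by
    simp only [Fintype.card_fin] at hGcard
    omega
  simp only [Finset.sum_add_distrib, Finset.sum_const, Finset.card_univ, Fintype.card_fin,
    smul_eq_mul, mul_one, Fintype.card_sum, Fintype.card_prod] at hcard h3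
  have h5 : M * N + M * N = N * (2 * M) := by ring
  omega

end PhaseRetrieval

theorem theorem1 (M N : ℕ) (hMN : M ≤ N) (hN : 4 * M ≤ N + 4) :
    PhaseRetrieval.Generically (fun a : PhaseRetrieval.Coord M N → ℝ =>
      PhaseRetrieval.IsFrame (PhaseRetrieval.realCoordEquiv M N a) ∧
        Function.Injective
          (PhaseRetrieval.intensityMap (PhaseRetrieval.realCoordEquiv M N a))) := by
  obtain ⟨p, hp0, hp⟩ :=
    PhaseRetrieval.exists_polynomial_vanishing_on_ambiguousSet hMN hN
  refine ⟨{a | MvPolynomial.eval a p ≠ 0}, ⟨{p}, ?_⟩, ?_, fun a ha => ?_⟩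
  · ext a
    simp
  · by_contra h
    rw [Set.not_nonempty_iff_eq_empty, Set.eq_empty_iff_forall_notMem] at h
    exact hp0 (MvPolynomial.funext fun a => by simpa using h a)
  · have hinj := PhaseRetrieval.injective_intensityMap_of_notMem fun h => ha (hp a h)
    exact ⟨PhaseRetrieval.isFrame_of_injective_intensityMap hinj, hinj⟩
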